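/- For integers $0\le d\le N$ let $\Lambda_{N,d}$ (the polytope of eigensteps of equal norm tight frames of $N$ vectors in a $d$-dimensional Hilbert space) be the set of all real matrices $\lambda=(\lambda_{i,n})_{1\le i\le d,\ 0\le n\le N}\in\mathbb R^{d\times(N+1)}$ such that $\lambda_{i,0}=0$ and $\lambda_{i,N}=N$ for $1\le i\le d$; $\sum_{i=1}^d\lambda_{i,n}=dn$ for $0\le n\le N$; $\lambda_{i,n}\le\lambda_{i,n+1}$ for $1\le i\le d$, $0\le n<N$; and $\lambda_{i,n}\le\lambda_{i-1,n-1}$ for $1<i\le d$, $0<n\le N$. A facet of a polytope $P$ is a face of dimension $\dim P-1$. **Theorem.** Let $2\le d\le N-2$. (a) The number of facets of $\Lambda_{N,d}$ is exactly $d(N-d-1)+(N-d)(d-1)-2$. (b) Suppose moreover $N\ge 5$, and consider, for indices $1\le i\le d$, $0\le n\le N$, the system consisting of 1. $\lambda_{i,n}=0$ for $i>n$; 2. $\lambda_{i,n}=N$ for $i<n+d-N+1$; 3. $\sum_{i=1}^d\lambda_{i,n}=dn$ for $0<n<N$; 4. $\lambda_{i,n}\le\lambda_{i,n+1}$ for $1\le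 i\le d$, $i\le n<N-d+i-1$; 5. $\lambda_{i,n}\le\lambda_{i-1,n-1}$ for $1<i\le d$, $i\le n<N-d+i$; 6. $\lambda_{d,d}\ge 0$ and $\lambda_{1,N-d}\le N$. Then the four inequalities $\lambda_{2,2}\le\lambda_{1,1}$, $\lambda_{1,1}\le\lambda_{1,2}$, $\lambda_{d,N-2}\le\lambda_{d,N-1}$ and $\lambda_{d,N-1}\le\lambda_{d-1,N-2}$ of this system can all be dropped: $\Lambda_{N,d}$ is the set of all $\lambda\in\mathbb R^{d\times(N+1)}$ satisfying the remaining conditions. The remaining description is non-redundant: for each remaining equation or inequality there is a point of $\mathbb R^{d\times(N+1)}$ that violates it and satisfies all other conditions of the system 1.–6. (including the four dropped ones). -/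

import Mathlib

/-- The entry `λ_{i,n}` of a `d × (N+1)` matrix, with rows numbered `1, …, d` and columns numbered
`0, …, N`.  It is only ever used for indices in this range (the value is `0` outside). -/
noncomputable def entry {N d : ℕ} (x : Matrix (Fin d) (Fin (N + 1)) ℝ) (i n : ℕ) : ℝ :=
  if h : (1 ≤ i ∧ i ≤ d) ∧ n ≤ N then x ⟨i - 1, by omega⟩ ⟨n, by omega⟩ else 0

/-- The polytope `Λ_{N,d}` of eigensteps of equal norm tight frames of `N` vectors in a
`d`-dimensional Hilbert space (squared norms `d`, frame operator `N • 1`). -/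
def eigensteps (N d : ℕ) : Set (Matrix (Fin d) (Fin (N + 1)) ℝ) :=
  {x | (∀ i, 1 ≤ i → i ≤ d → entry x i 0 = 0) ∧
       (∀ i, 1 ≤ i → i ≤ d → entry x i N = N) ∧
       (∀ n, n ≤ N → ∑ i ∈ Finset.Icc 1 d, entry x i n = d * n) ∧
       (∀ i n, 1 ≤ i → i ≤ d → n < N → entry x i n ≤ entry x i (n + 1)) ∧
       (∀ i n, 1 < i → i ≤ d → 0 < n → n ≤ N → entry x i n ≤ entry x (i - 1) (n - 1))}

/-- `F` is a facet of the convex set `P`: a nonempty face (cut out by a supporting hyperplane) whose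
dimension, i.e. that of its affine hull, is one less than the dimension of `P`. -/
def IsFacet {E : Type*} [AddCommGroup E] [Module ℝ E] [FiniteDimensional ℝ E] [TopologicalSpace E]
    (P F : Set E) : Prop :=
  F.Nonempty ∧ IsExposed ℝ P F ∧
    Module.finrank ℝ (vectorSpan ℝ F) + 1 = Module.finrank ℝ (vectorSpan ℝ P)

/-- The equations and inequalities (before discarding the four exceptional ones) of the reduced
description of `Λ_{N,d}`. -/
inductive Condition (N d : ℕ) : Type
  /-- `λ_{i,n} = 0` for `i > n` -/
  | zeroTriangle (i n : ℕ) (hi : 1 ≤ i ∧ i ≤ d) (hn : n ≤ N) (h : n < i)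
  /-- `λ_{i,n} = N` for `i < n + d - N + 1` -/
  | topTriangle (i n : ℕ) (hi : 1 ≤ i ∧ i ≤ d) (hn : n ≤ N) (h : i + N < n + d + 1)
  /-- `∑ i, λ_{i,n} = d n` for `0 < n < N` -/
  | columnSum (n : ℕ) (hn : 0 < n ∧ n < N)
  /-- `λ_{i,n} ≤ λ_{i,n+1}` for `1 ≤ i ≤ d`, `i ≤ n < N - d + i - 1` -/
  | horizontal (i n : ℕ) (hi : 1 ≤ i ∧ i ≤ d) (hn : i ≤ n ∧ n + d + 1 < N + i)
  /-- `λ_{i,n} ≤ λ_{i-1,n-1}` for `1 < i ≤ d`, `i ≤ n < N - d + i` -/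
  | diagonal (i n : ℕ) (hi : 1 < i ∧ i ≤ d) (hn : i ≤ n ∧ n + d < N + i)
  /-- `λ_{d,d} ≥ 0` -/
  | lowerBound
  /-- `λ_{1,N-d} ≤ N` -/
  | upperBound

/-- The matrix `x` satisfies the given equation or inequality. -/
def Condition.Holds {N d : ℕ} (x : Matrix (Fin d) (Fin (N + 1)) ℝ) : Condition N d → Prop
  | .zeroTriangle i n _ _ _ => entry x i n = 0
  | .topTriangle i n _ _ _ => entry x i n = N
  | .columnSum n _ => ∑ i ∈ Finset.Icc 1 d, entry x i n = d * n
  | .horizontal i n _ _ => entry x i n ≤ entry x i (n + 1)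
  | .diagonal i n _ _ => entry x i n ≤ entry x (i - 1) (n - 1)
  | .lowerBound => 0 ≤ entry x d d
  | .upperBound => entry x 1 (N - d) ≤ N

/-- The four exceptional inequalities `λ_{1,1} ≤ λ_{1,2}`, `λ_{d,N-2} ≤ λ_{d,N-1}`,
`λ_{2,2} ≤ λ_{1,1}` and `λ_{d,N-1} ≤ λ_{d-1,N-2}`. -/
def Condition.IsExceptional {N d : ℕ} : Condition N d → Prop
  | .horizontal i n _ _ => (i = 1 ∧ n = 1) ∨ (i = d ∧ n = N - 2)
  | .diagonal i n _ _ => (i = 2 ∧ n = 2) ∨ (i = d ∧ n = N - 1)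
  | _ => False

/-!
The eigensteps are cut out of the affine space given by the equations of the reduced description by
finitely many inequalities.  For any such polyhedron, a description by inequalities which are all
slack at some point, and each of which is violated by a point satisfying all the others, has as many
inequalities as the polyhedron has facets (`ncard_isFacet_polyhedron`): the segment from the first
point to the second leaves the polyhedron at a point where exactly one inequality is tight.  So both
parts of the theorem reduce to finding a central point and points violating a single condition.

Call an entry free if it is not forced to be `0` or `N`, that is, if `i ≤ n < N - d + i`.  The entries
`n + d + 1 - 2i` in the free region have the prescribed column sums, and at the resulting point
every inequality is slack by exactly `1` (`form_centre`).  Adding a perturbation `u` with vanishing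
column sums, supported in the free region, satisfies an inequality `λ_{i,n} ≤ λ_{i',n'}` if and only if
`u i n - u i' n' ≤ 1`.  It remains to find, for every inequality that is not exceptional, a `u` for which
the difference is `2` there and at most `1` elsewhere:

* The inequalities between the free entries of two consecutive columns compare consecutive entries
  of a zigzag path which alternates between the columns.  Unless one of the columns has only one free
  entry, which happens just for the exceptional inequalities, there is room for two entries `1` and two
  entries `-1`, one of each in each column, such that a `1` is followed by a `-1` only at the given place
  (`Condition.exists_violation_horizontal`, `Condition.exists_violation_diagonal`).
* For the two bounds, the corner entry `∓2` is balanced within its column, and in one neighbouring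
  column if necessary (`Condition.exists_violation_lowerBound`).

The exceptional inequalities are redundant for `N ≥ 5` because of the column sums next to the corners
of the free region (`holds_of_forall_not_isExceptional`).  For `N = 4` more inequalities coincide, but
the polytope is a segment, which has two facets (`ncard_isFacet_eigensteps_four_two`).
-/

open Filter Topology

/-! ### Facets of a polyhedron -/

section Facets

variable {E : Type*} [AddCommGroup E] [Module ℝ E]

/-- Moving a little in a direction `v` keeps all constraints satisfied, provided that each of them is
slack at `z` or does not increase along `v`. -/
lemma exists_pos_forall_le {ι : Type*} [Finite ι] (ℓ : ι → E →ₗ[ℝ] ℝ) (b : ι → ℝ) (z v : E)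
    (h : ∀ c, ℓ c z < b c ∨ ℓ c z ≤ b c ∧ ℓ c v ≤ 0) :
    ∃ ε : ℝ, 0 < ε ∧ ∀ c, ℓ c (z + ε • v) ≤ b c := by
  have key : ∀ᶠ ε : ℝ in 𝓝[>] 0, ∀ c, ℓ c (z + ε • v) ≤ b c := by
    rw [eventually_all]
    intro c
    simp only [map_add, map_smul, smul_eq_mul]
    rcases h c with h | ⟨h, hv⟩
    · have hc : Tendsto (fun ε : ℝ => ℓ c z + ε * ℓ c v) (𝓝[>] 0) (𝓝 (ℓ c z + 0 * ℓ c v)) :=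
        ((continuous_const.add (continuous_id.mul continuous_const)).tendsto 0).mono_left
          nhdsWithin_le_nhds
      rw [zero_mul, add_zero] at hc
      exact (hc.eventually_lt_const h).mono fun _ => le_of_lt
    · filter_upwards [self_mem_nhdsWithin] with ε hε
      have : ε * ℓ c v ≤ 0 := mul_nonpos_of_nonneg_of_nonpos (le_of_lt hε) hv
      linarith
  obtain ⟨ε, hε, h0⟩ := (key.and self_mem_nhdsWithin).exists
  exact ⟨ε, h0, hε⟩

lemma mem_vectorSpan_of_add_smul_mem {F : Set E} {z v : E} {ε : ℝ} (hε : 0 < ε) (hz : z ∈ F)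
    (hzv : z + ε • v ∈ F) : v ∈ vectorSpan ℝ F := by
  have h := vsub_mem_vectorSpan ℝ hzv hz
  rw [vsub_eq_sub, add_sub_cancel_left] at h
  simpa [smul_smul, inv_mul_cancel₀ hε.ne'] using Submodule.smul_mem _ ε⁻¹ h

lemma finrank_inf_ker_add_one [FiniteDimensional ℝ E] (D : Submodule ℝ E) (f : E →ₗ[ℝ] ℝ)
    (h : ∃ v ∈ D, f v ≠ 0) :
    Module.finrank ℝ (D ⊓ LinearMap.ker f : Submodule ℝ E) + 1 = Module.finrank ℝ D := by
  obtain ⟨v, hv, hfv⟩ := h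
  have h1 := LinearMap.finrank_range_add_finrank_ker (f.comp D.subtype)
  have h2 : LinearMap.range (f.comp D.subtype) = ⊤ :=
    LinearMap.range_eq_top.2 (LinearMap.surjective fun h0 => hfv (by
      simpa using LinearMap.congr_fun h0 ⟨v, hv⟩))
  rw [h2, finrank_top, Module.finrank_self, LinearMap.ker_comp,
    ← Submodule.finrank_map_subtype_eq, Submodule.map_comap_subtype] at h1
  omega

/-- The polyhedron cut out by finitely many inequalities in an affine subspace. -/
def polyhedron {ι : Type*} (A : AffineSubspace ℝ E) (ℓ : ι → E →ₗ[ℝ] ℝ) (b : ι → ℝ) : Set E :=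
  {x | x ∈ A ∧ ∀ c, ℓ c x ≤ b c}

lemma convex_polyhedron {ι : Type*} (A : AffineSubspace ℝ E) (ℓ : ι → E →ₗ[ℝ] ℝ) (b : ι → ℝ) :
    Convex ℝ (polyhedron A ℓ b) := by
  have : polyhedron A ℓ b = (A : Set E) ∩ ⋂ c, {x | ℓ c x ≤ b c} := by
    ext x; simp [polyhedron]
  rw [this]
  exact A.convex.inter (convex_iInter fun c => convex_halfSpace_le (ℓ c).isLinear (b c))

/-- A point at which all constraints are slack makes the polyhedron full-dimensional in `A`. -/
lemma exists_add_smul_mem_polyhedron {ι : Type*} [Finite ι] {A : AffineSubspace ℝ E}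
    {ℓ : ι → E →ₗ[ℝ] ℝ} {b : ι → ℝ} {p : E} (hp : p ∈ A) (hpos : ∀ c, ℓ c p < b c) {v : E}
    (hv : v ∈ A.direction) : ∃ ε : ℝ, 0 < ε ∧ p + ε • v ∈ polyhedron A ℓ b := by
  obtain ⟨ε, h0, hε⟩ := exists_pos_forall_le ℓ b p v fun c => Or.inl (hpos c)
  refine ⟨ε, h0, ?_, hε⟩
  rw [add_comm]
  exact A.vadd_mem_of_mem_direction (Submodule.smul_mem _ ε hv) hp

lemma vectorSpan_polyhedron {ι : Type*} [Finite ι] {A : AffineSubspace ℝ E}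
    {ℓ : ι → E →ₗ[ℝ] ℝ} {b : ι → ℝ} {p : E} (hp : p ∈ A) (hpos : ∀ c, ℓ c p < b c) :
    vectorSpan ℝ (polyhedron A ℓ b) = A.direction := by
  apply le_antisymm
  · exact vectorSpan_mono ℝ fun x hx => hx.1
  · intro v hv
    obtain ⟨ε, h0, hε⟩ := exists_add_smul_mem_polyhedron hp hpos hv
    exact mem_vectorSpan_of_add_smul_mem h0 ⟨hp, fun c => (hpos c).le⟩ hε

lemma vectorSpan_polyhedron_inter {ι : Type*} [Finite ι] {A : AffineSubspace ℝ E}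
    {ℓ : ι → E →ₗ[ℝ] ℝ} {b : ι → ℝ} {c : ι} {y : E} (hy : y ∈ A) (hyc : ℓ c y = b c)
    (hpos : ∀ c', c' ≠ c → ℓ c' y < b c') :
    vectorSpan ℝ {x ∈ polyhedron A ℓ b | ℓ c x = b c} = A.direction ⊓ LinearMap.ker (ℓ c) := by
  have hyP : y ∈ polyhedron A ℓ b := ⟨hy, fun c' => by
    by_cases h : c' = c
    · rw [h, hyc]
    · exact (hpos c' h).le⟩
  apply le_antisymm
  · refine le_inf (vectorSpan_mono ℝ fun x hx => hx.1.1) ?_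
    rw [vectorSpan_def, Submodule.span_le]
    rintro _ ⟨x, hx, x', hx', rfl⟩
    simp [hx.2, hx'.2]
  · rintro v ⟨hv, hvc⟩
    rw [SetLike.mem_coe, LinearMap.mem_ker] at hvc
    obtain ⟨ε, h0, hε⟩ := exists_pos_forall_le ℓ b y v fun c' => by
      by_cases h : c' = c
      · rw [h]; exact Or.inr ⟨hyc.le, hvc.le⟩
      · exact Or.inl (hpos c' h)
    refine mem_vectorSpan_of_add_smul_mem h0 (z := y) ⟨hyP, hyc⟩ ⟨⟨?_, hε⟩, ?_⟩
    · rw [add_comm]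
      exact A.vadd_mem_of_mem_direction (Submodule.smul_mem _ ε hv) hy
    · simp [hvc, hyc]

/-- If every constraint is slack at some point of a convex set `F` inside the polyhedron, then all
of them are slack simultaneously at a point of `F`. -/
lemma exists_forall_lt {ι : Type*} [Finite ι] {A : AffineSubspace ℝ E}
    {ℓ : ι → E →ₗ[ℝ] ℝ} {b : ι → ℝ} {F : Set E} (hF : Convex ℝ F) (hne : F.Nonempty)
    (hFP : F ⊆ polyhedron A ℓ b) (h : ∀ c, ∃ z ∈ F, ℓ c z < b c) :
    ∃ z ∈ F, ∀ c, ℓ c z < b c := by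
  classical
  cases nonempty_fintype ι
  have key : ∀ s : Finset ι, ∃ z ∈ F, ∀ c ∈ s, ℓ c z < b c := by
    intro s
    induction s using Finset.induction_on with
    | empty => exact ⟨hne.some, hne.some_mem, by simp⟩
    | insert c s _ ih =>
      obtain ⟨z, hz, hzs⟩ := ih
      obtain ⟨w, hw, hwc⟩ := h c
      refine ⟨(1 / 2 : ℝ) • z + (1 / 2 : ℝ) • w, hF hz hw (by norm_num) (by norm_num)
        (by norm_num), fun c' hc' => ?_⟩
      simp only [map_add, map_smul, smul_eq_mul]
      have h1 := (hFP hz).2 c'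
      have h2 := (hFP hw).2 c'
      rcases Finset.mem_insert.1 hc' with rfl | hc'
      · linarith
      · linarith [hzs c' hc']
  obtain ⟨z, hz, h⟩ := key Finset.univ
  exact ⟨z, hz, fun c => h c (Finset.mem_univ c)⟩

variable [FiniteDimensional ℝ E] [TopologicalSpace E]

/-- A facet of a polyhedron is contained in one of the hyperplanes bounding it: otherwise it has a
point at which all constraints are slack, and the functional exposing it is constant. -/
lemma exists_eq_of_isFacet {ι : Type*} [Finite ι] {A : AffineSubspace ℝ E}
    {ℓ : ι → E →ₗ[ℝ] ℝ} {b : ι → ℝ} {F : Set E} (hF : IsFacet (polyhedron A ℓ b) F) :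
    ∃ c, ∀ x ∈ F, ℓ c x = b c := by
  obtain ⟨hne, hexp, hrank⟩ := hF
  by_contra! hcon
  have hsub : F ⊆ polyhedron A ℓ b := hexp.subset
  obtain ⟨z, hz, hzpos⟩ := exists_forall_lt (hexp.convex (convex_polyhedron A ℓ b)) hne hsub
    fun c => by
      obtain ⟨x, hx, hne⟩ := hcon c
      exact ⟨x, hx, lt_of_le_of_ne ((hsub hx).2 c) hne⟩
  obtain ⟨f, hf⟩ := hexp hne
  have hmax : ∀ y ∈ polyhedron A ℓ b, f y ≤ f z := by
    rw [hf] at hz; exact hz.2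
  have hdir : ∀ v ∈ A.direction, f v ≤ 0 := fun v hv => by
    obtain ⟨ε, h0, hε⟩ := exists_add_smul_mem_polyhedron (hsub hz).1 hzpos hv
    have := hmax _ hε
    rw [map_add, map_smul, smul_eq_mul] at this
    nlinarith
  have hFP : F = polyhedron A ℓ b := by
    refine hsub.antisymm fun x hx => ?_
    rw [hf]
    refine ⟨hx, fun y hy => (hmax y hy).trans ?_⟩
    have := hdir (z - x) (A.vsub_mem_direction (hsub hz).1 hx.1)
    rw [map_sub] at this
    linarith
  rw [hFP] at hrank
  omega

variable [IsTopologicalAddGroup E] [ContinuousSMul ℝ E] [T2Space E]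

lemma isFacet_polyhedron_inter {ι : Type*} [Finite ι] {A : AffineSubspace ℝ E}
    {ℓ : ι → E →ₗ[ℝ] ℝ} {b : ι → ℝ} {c : ι} {p y : E} (hp : p ∈ A) (hppos : ∀ c, ℓ c p < b c)
    (hy : y ∈ A) (hyc : ℓ c y = b c) (hpos : ∀ c', c' ≠ c → ℓ c' y < b c') :
    IsFacet (polyhedron A ℓ b) {x ∈ polyhedron A ℓ b | ℓ c x = b c} := by
  have hyP : y ∈ polyhedron A ℓ b := ⟨hy, fun c' => by
    by_cases h : c' = c
    · rw [h, hyc]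
    · exact (hpos c' h).le⟩
  refine ⟨⟨y, hyP, hyc⟩, fun _ => ⟨LinearMap.toContinuousLinearMap (ℓ c), ?_⟩, ?_⟩
  · ext x
    simp only [Set.mem_ofPred_eq, LinearMap.coe_toContinuousLinearMap']
    refine and_congr_right fun hx => ⟨fun h z hz => h ▸ hz.2 c, fun h => ?_⟩
    exact le_antisymm (hx.2 c) (hyc ▸ h y hyP)
  · rw [vectorSpan_polyhedron_inter hy hyc hpos, vectorSpan_polyhedron hp hppos]
    refine finrank_inf_ker_add_one _ _ ⟨y - p, A.vsub_mem_direction hy hp, ?_⟩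
    rw [map_sub, hyc]
    linarith [hppos c]

/-- The facets of a polyhedron correspond to the inequalities of a non-redundant description: if
all constraints are slack at some point, and each of them is violated by a point satisfying all the
others, then there are exactly as many facets as constraints. -/
theorem ncard_isFacet_polyhedron {ι : Type*} [Finite ι] (A : AffineSubspace ℝ E)
    (ℓ : ι → E →ₗ[ℝ] ℝ) (b : ι → ℝ) (p : E) (hp : p ∈ A) (hpos : ∀ c, ℓ c p < b c)
    (h : ∀ c, ∃ x ∈ A, b c < ℓ c x ∧ ∀ c', c' ≠ c → ℓ c' x ≤ b c') :
    {F | IsFacet (polyhedron A ℓ b) F}.ncard = Nat.card ι := by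
  -- the segment from `p` to the point violating only `c` leaves the polyhedron inside the facet `c`
  have hy : ∀ c, ∃ y ∈ A, ℓ c y = b c ∧ ∀ c', c' ≠ c → ℓ c' y < b c' := fun c => by
    obtain ⟨x, hxA, hxc, hx⟩ := h c
    have hpc := hpos c
    set t : ℝ := (b c - ℓ c p) / (ℓ c x - ℓ c p) with ht
    have ht0 : 0 < t := div_pos (by linarith) (by linarith)
    have ht1 : t < 1 := (div_lt_one (by linarith)).2 (by linarith)
    have htc : t * (ℓ c x - ℓ c p) = b c - ℓ c p := div_mul_cancel₀ _ (by linarith)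
    refine ⟨AffineMap.lineMap p x t, AffineMap.lineMap_mem t hp hxA, ?_, fun c' hc' => ?_⟩
    · simp only [AffineMap.lineMap_apply_module', map_add, map_smul, map_sub, smul_eq_mul]
      linarith
    · simp only [AffineMap.lineMap_apply_module', map_add, map_smul, map_sub, smul_eq_mul]
      nlinarith [hx c' hc', hpos c']
  choose y hyA hyc hyo using hy
  have hinj : Function.Injective fun c => {x ∈ polyhedron A ℓ b | ℓ c x = b c} := by
    intro c c' hcc
    by_contra hne
    have hmem : y c ∈ {x ∈ polyhedron A ℓ b | ℓ c x = b c} :=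
      ⟨⟨hyA c, fun e => by
        by_cases he : e = c
        · rw [he, hyc]
        · exact (hyo c e he).le⟩, hyc c⟩
    have hcc' : {x ∈ polyhedron A ℓ b | ℓ c x = b c} = {x ∈ polyhedron A ℓ b | ℓ c' x = b c'} :=
      hcc
    rw [hcc'] at hmem
    exact (hyo c c' (Ne.symm hne)).ne hmem.2
  have hrange : {F | IsFacet (polyhedron A ℓ b) F} =
      Set.range fun c => {x ∈ polyhedron A ℓ b | ℓ c x = b c} := by
    ext F
    constructor
    · intro hF
      obtain ⟨c, hc⟩ := exists_eq_of_isFacet hF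
      obtain ⟨hne, hexp, hrank⟩ := hF
      refine ⟨c, ?_⟩
      have hsub : F ⊆ {x ∈ polyhedron A ℓ b | ℓ c x = b c} := fun x hx =>
        ⟨hexp.subset hx, hc x hx⟩
      have hfacet := isFacet_polyhedron_inter hp hpos (hyA c) (hyc c) (hyo c)
      have hspan := Submodule.eq_of_le_of_finrank_eq (vectorSpan_mono ℝ hsub) (by
        have := hfacet.2.2
        omega)
      -- the functional exposing `F` vanishes on the common direction of `F` and the facet `c`
      obtain ⟨f, hf⟩ := hexp hne
      obtain ⟨z, hz⟩ := hne
      have hzmax := hz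
      rw [hf] at hzmax
      have hker : vectorSpan ℝ F ≤ LinearMap.ker (f : E →ₗ[ℝ] ℝ) := by
        rw [vectorSpan_def, Submodule.span_le]
        rintro _ ⟨x, hx, x', hx', rfl⟩
        rw [hf] at hx hx'
        have h1 := hx.2 x' hx'.1
        have h2 := hx'.2 x hx.1
        simp only [SetLike.mem_coe, LinearMap.mem_ker, vsub_eq_sub, map_sub,
          ContinuousLinearMap.coe_coe]
        linarith
      refine Set.Subset.antisymm (fun x hx => ?_) hsub
      have hx0 := hker (hspan ▸ vsub_mem_vectorSpan ℝ hx (hsub hz))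
      simp only [LinearMap.mem_ker, vsub_eq_sub, map_sub, ContinuousLinearMap.coe_coe] at hx0
      rw [hf]
      exact ⟨hx.1, fun w hw => by linarith [hzmax.2 w hw]⟩
    · rintro ⟨c, rfl⟩
      exact isFacet_polyhedron_inter hp hpos (hyA c) (hyc c) (hyo c)
  rw [hrange, ← Set.image_univ, Set.ncard_image_of_injective _ hinj, Set.ncard_univ]

end Facets

/-! ### The conditions as affine-linear conditions -/

section Description

variable {N d : ℕ}

/-- The `(i, n)` entry as a linear functional. -/
noncomputable def entryForm (N d i n : ℕ) : Matrix (Fin d) (Fin (N + 1)) ℝ →ₗ[ℝ] ℝ where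
  toFun x := entry x i n
  map_add' x y := by unfold entry; split_ifs <;> simp
  map_smul' r x := by unfold entry; split_ifs <;> simp

@[simp] lemma entryForm_apply (i n : ℕ) (x : Matrix (Fin d) (Fin (N + 1)) ℝ) :
    entryForm N d i n x = entry x i n := rfl

/-- The matrix with entries `f i n`, for `1 ≤ i ≤ d` and `0 ≤ n ≤ N`. -/
def ofEntries (N d : ℕ) (f : ℕ → ℕ → ℝ) : Matrix (Fin d) (Fin (N + 1)) ℝ :=
  fun a b => f (a + 1) b

lemma entry_ofEntries (f : ℕ → ℕ → ℝ) {i n : ℕ} (hi : 1 ≤ i) (hi' : i ≤ d) (hn : n ≤ N) :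
    entry (ofEntries N d f) i n = f i n := by
  have h : (1 ≤ i ∧ i ≤ d) ∧ n ≤ N := ⟨⟨hi, hi'⟩, hn⟩
  simp only [entry, dif_pos h, ofEntries, Nat.sub_add_cancel hi]

lemma sum_entry_ofEntries (f : ℕ → ℕ → ℝ) {n : ℕ} (hn : n ≤ N) :
    ∑ i ∈ Finset.Icc 1 d, entry (ofEntries N d f) i n = ∑ i ∈ Finset.Icc 1 d, f i n :=
  Finset.sum_congr rfl fun i hi => by
    rw [Finset.mem_Icc] at hi
    exact entry_ofEntries f hi.1 hi.2 hn

namespace Condition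

/-- The condition is an inequality. -/
def IsIneq : Condition N d → Prop
  | .zeroTriangle .. => False
  | .topTriangle .. => False
  | .columnSum .. => False
  | _ => True

/-- The linear functional of a condition, which is required to be equal to `c.bound` for an equation
and at most `c.bound` for an inequality. -/
noncomputable def form : Condition N d → Matrix (Fin d) (Fin (N + 1)) ℝ →ₗ[ℝ] ℝ
  | .zeroTriangle i n _ _ _ => entryForm N d i n
  | .topTriangle i n _ _ _ => entryForm N d i n
  | .columnSum n _ => ∑ i ∈ Finset.Icc 1 d, entryForm N d i n
  | .horizontal i n _ _ => entryForm N d i n - entryForm N d i (n + 1)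
  | .diagonal i n _ _ => entryForm N d i n - entryForm N d (i - 1) (n - 1)
  | .lowerBound => -entryForm N d d d
  | .upperBound => entryForm N d 1 (N - d)

/-- The right-hand side of a condition, see `Condition.form`. -/
def bound : Condition N d → ℝ
  | .topTriangle .. => N
  | .columnSum n _ => d * n
  | .upperBound => N
  | _ => 0

lemma holds_iff_eq {c : Condition N d} (hc : ¬ c.IsIneq) (x : Matrix (Fin d) (Fin (N + 1)) ℝ) :
    c.Holds x ↔ c.form x = c.bound := by
  cases c <;> simp [IsIneq, Holds, form, bound] at hc ⊢

lemma holds_iff_le {c : Condition N d} (hc : c.IsIneq) (x : Matrix (Fin d) (Fin (N + 1)) ℝ) :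
    c.Holds x ↔ c.form x ≤ c.bound := by
  cases c <;> simp [IsIneq, Holds, form, bound] at hc ⊢

/-- The value at the matrix with entries `u i n` of the linear functional of a condition. -/
def formEntries (u : ℕ → ℕ → ℝ) : Condition N d → ℝ
  | .zeroTriangle i n _ _ _ => u i n
  | .topTriangle i n _ _ _ => u i n
  | .columnSum n _ => ∑ i ∈ Finset.Icc 1 d, u i n
  | .horizontal i n _ _ => u i n - u i (n + 1)
  | .diagonal i n _ _ => u i n - u (i - 1) (n - 1)
  | .lowerBound => -u d d
  | .upperBound => u 1 (N - d)

lemma form_ofEntries (hd : 1 ≤ d) (hdN : d ≤ N) (u : ℕ → ℕ → ℝ) (c : Condition N d) :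
    c.form (ofEntries N d u) = c.formEntries u := by
  cases c with
  | zeroTriangle i n hi hn h => exact entry_ofEntries u hi.1 hi.2 hn
  | topTriangle i n hi hn h => exact entry_ofEntries u hi.1 hi.2 hn
  | columnSum n hn =>
    simp only [form, formEntries, LinearMap.sum_apply, entryForm_apply]
    exact sum_entry_ofEntries u hn.2.le
  | horizontal i n hi hn =>
    simp only [form, formEntries, LinearMap.sub_apply, entryForm_apply]
    rw [entry_ofEntries u hi.1 hi.2 (by omega), entry_ofEntries u hi.1 hi.2 (by omega)]
  | diagonal i n hi hn =>
    simp only [form, formEntries, LinearMap.sub_apply, entryForm_apply]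
    rw [entry_ofEntries u hi.1.le hi.2 (by omega),
      entry_ofEntries u (by omega) (by omega) (by omega)]
  | lowerBound =>
    simp only [form, formEntries, LinearMap.neg_apply, entryForm_apply]
    rw [entry_ofEntries u hd le_rfl hdN]
  | upperBound => exact entry_ofEntries u le_rfl hd (Nat.sub_le _ _)

end Condition

end Description

/-! ### The centre and its perturbations -/

section Centre

variable {N d : ℕ}

/-- The entries of the most central eigensteps: `n + d + 1 - 2i` wherever the entry is not forced to
be `0` or `N`.  All inequalities of the reduced description are slack by exactly `1` there. -/
noncomputable def centreEntries (N d i n : ℕ) : ℝ :=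
  if n < i then 0 else if i + N < n + d + 1 then N else n + d + 1 - 2 * i

lemma sum_centreEntries (hdN : d ≤ N) {n : ℕ} (hn : n ≤ N) :
    ∑ i ∈ Finset.Icc 1 d, centreEntries N d i n = d * n := by
  obtain ⟨k, rfl⟩ := Nat.exists_eq_add_of_le hdN
  -- the partial column sums, the middle branch being a telescoping sum of `n + d + 1 - 2i`
  have key : ∀ m : ℕ, m ≤ d → ∑ i ∈ Finset.Icc 1 m, centreEntries (d + k) d i n =
      if m + k ≤ n then ((d : ℝ) + k) * m else if m ≤ n then (m : ℝ) * (n + d - m) else d * n := by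
    intro m
    induction m with
    | zero =>
      intro _
      split_ifs <;> simp_all
    | succ m ih =>
      intro hm
      rw [Finset.sum_Icc_succ_top (by omega), ih (by omega), centreEntries]
      have e1 : m + k = n → (m : ℝ) + k = n := fun h => by exact_mod_cast h
      have e2 : m = n → (m : ℝ) = n := fun h => by exact_mod_cast h
      push_cast
      -- at a boundary between two branches, `m` is `n - k` or `n`
      split_ifs <;>
        first
        | omega
        | ring1
        | rw [← e1 (by omega)]; ring1
        | rw [← e2 (by omega)]; ring1
        | rw [← e1 (by omega), show k = 0 by omega]; push_cast; ring1
  rw [key d le_rfl]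
  split_ifs with h1 h2
  · have : (n : ℝ) = d + k := by exact_mod_cast (by omega : n = d + k)
    rw [this]; ring
  · ring
  · rfl

lemma form_centre (hd : 1 ≤ d) (hdN : d + 1 ≤ N) (c : Condition N d) :
    (c.IsIneq → c.form (ofEntries N d (centreEntries N d)) = c.bound - 1) ∧
    (¬ c.IsIneq → c.form (ofEntries N d (centreEntries N d)) = c.bound) := by
  rw [Condition.form_ofEntries hd (by omega)]
  cases c with
  | zeroTriangle i n hi hn h =>
    simp [Condition.IsIneq, Condition.formEntries, Condition.bound, centreEntries, h]
  | topTriangle i n hi hn h =>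
    have h' : ¬ n < i := by omega
    simp [Condition.IsIneq, Condition.formEntries, Condition.bound, centreEntries, h, h']
  | columnSum n hn =>
    simp only [Condition.IsIneq, Condition.formEntries, Condition.bound]
    exact ⟨False.elim, fun _ => sum_centreEntries (by omega) hn.2.le⟩
  | horizontal i n hi hn =>
    simp only [Condition.IsIneq, Condition.formEntries, Condition.bound, centreEntries]
    rw [if_neg (by omega), if_neg (by omega), if_neg (by omega), if_neg (by omega)]
    refine ⟨fun _ => by push_cast; ring, fun h => (h trivial).elim⟩
  | diagonal i n hi hn =>
    simp only [Condition.IsIneq, Condition.formEntries, Condition.bound, centreEntries]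
    rw [if_neg (by omega), if_neg (by omega), if_neg (by omega), if_neg (by omega),
      Nat.cast_sub (by omega), Nat.cast_sub (by omega)]
    refine ⟨fun _ => by push_cast; ring, fun h => (h trivial).elim⟩
  | lowerBound =>
    simp only [Condition.IsIneq, Condition.formEntries, Condition.bound, centreEntries]
    rw [if_neg (by omega), if_neg (by omega)]
    refine ⟨fun _ => by ring, fun h => (h trivial).elim⟩
  | upperBound =>
    simp only [Condition.IsIneq, Condition.formEntries, Condition.bound, centreEntries]
    rw [if_neg (by omega), if_neg (by omega), Nat.cast_sub (by omega)]
    refine ⟨fun _ => by push_cast; ring, fun h => (h trivial).elim⟩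

/-- The centre moved by the matrix with entries `u i n`. -/
noncomputable def perturb (N d : ℕ) (u : ℕ → ℕ → ℝ) : Matrix (Fin d) (Fin (N + 1)) ℝ :=
  ofEntries N d (centreEntries N d) + ofEntries N d u

namespace Condition

lemma holds_perturb_iff_eq (hd : 1 ≤ d) (hdN : d + 1 ≤ N) {c : Condition N d} (hc : ¬ c.IsIneq)
    (u : ℕ → ℕ → ℝ) : c.Holds (perturb N d u) ↔ c.formEntries u = 0 := by
  rw [holds_iff_eq hc, perturb, map_add, (form_centre hd hdN c).2 hc,
    form_ofEntries hd (by omega), add_eq_left]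

lemma holds_perturb_iff_le (hd : 1 ≤ d) (hdN : d + 1 ≤ N) {c : Condition N d} (hc : c.IsIneq)
    (u : ℕ → ℕ → ℝ) : c.Holds (perturb N d u) ↔ c.formEntries u ≤ 1 := by
  rw [holds_iff_le hc, perturb, map_add, (form_centre hd hdN c).1 hc,
    form_ofEntries hd (by omega)]
  constructor <;> intro h <;> linarith

end Condition

end Centre

/-! ### The reduced description -/

section Equivalence

variable {N d : ℕ}

lemma entry_anti_diagonal {x : Matrix (Fin d) (Fin (N + 1)) ℝ}
    (h : ∀ i n, 1 < i → i ≤ d → 0 < n → n ≤ N → entry x i n ≤ entry x (i - 1) (n - 1))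
    {i n : ℕ} (hi : 1 ≤ i) (t : ℕ) (ht : i + t ≤ d) (hn : n + t ≤ N) :
    entry x (i + t) (n + t) ≤ entry x i n := by
  induction t with
  | zero => exact le_rfl
  | succ t ih =>
    exact (h (i + (t + 1)) (n + (t + 1)) (by omega) ht (by omega) hn).trans
      (ih (by omega) (by omega))

lemma entry_mono_horizontal {x : Matrix (Fin d) (Fin (N + 1)) ℝ}
    (h : ∀ i n, 1 ≤ i → i ≤ d → n < N → entry x i n ≤ entry x i (n + 1))
    {i n : ℕ} (hi : 1 ≤ i) (hi' : i ≤ d) (t : ℕ) (hn : n + t ≤ N) :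
    entry x i n ≤ entry x i (n + t) := by
  induction t with
  | zero => exact le_rfl
  | succ t ih => exact (ih (by omega)).trans (h i (n + t) hi hi' (by omega))

lemma holds_of_mem_eigensteps (hd : 1 ≤ d) (hdN : d ≤ N) {x : Matrix (Fin d) (Fin (N + 1)) ℝ}
    (hx : x ∈ eigensteps N d) (c : Condition N d) : c.Holds x := by
  obtain ⟨h0, hN, hsum, hhor, hdiag⟩ := hx
  cases c with
  | zeroTriangle i n hi hn h =>
    have h1 := entry_anti_diagonal hdiag (i := i - n) (n := 0) (by omega) n (by omega) (by omega)
    have h2 := entry_mono_horizontal hhor (n := 0) hi.1 hi.2 n (by omega)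
    rw [h0 _ (by omega) (by omega), zero_add, Nat.sub_add_cancel h.le] at h1
    rw [h0 _ hi.1 hi.2, zero_add] at h2
    exact le_antisymm h1 h2
  | topTriangle i n hi hn h =>
    have h1 := entry_anti_diagonal hdiag (n := n) hi.1 (N - n) (by omega) (by omega)
    have h2 := entry_mono_horizontal hhor (n := n) hi.1 hi.2 (N - n) (by omega)
    rw [show n + (N - n) = N by omega, hN _ (by omega) (by omega)] at h1
    rw [show n + (N - n) = N by omega, hN _ hi.1 hi.2] at h2
    exact le_antisymm h2 h1
  | columnSum n hn => exact hsum n hn.2.le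
  | horizontal i n hi hn => exact hhor i n hi.1 hi.2 (by omega)
  | diagonal i n hi hn => exact hdiag i n hi.1 hi.2 (by omega) (by omega)
  | lowerBound =>
    have h2 := entry_mono_horizontal hhor (n := 0) hd le_rfl d (by omega)
    rwa [h0 _ hd le_rfl, zero_add] at h2
  | upperBound =>
    have h2 := entry_mono_horizontal hhor (n := N - d) le_rfl hd d (by omega)
    rwa [Nat.sub_add_cancel hdN, hN _ le_rfl hd] at h2

lemma mem_eigensteps_of_holds (hdN : d < N) {x : Matrix (Fin d) (Fin (N + 1)) ℝ}
    (hx : ∀ c : Condition N d, c.Holds x) : x ∈ eigensteps N d := by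
  have hzero : ∀ i n, 1 ≤ i → i ≤ d → n < i → entry x i n = 0 := fun i n h1 h2 h3 =>
    hx (.zeroTriangle i n ⟨h1, h2⟩ (by omega) h3)
  have htop : ∀ i n, 1 ≤ i → i ≤ d → n ≤ N → i + N < n + d + 1 → entry x i n = N :=
    fun i n h1 h2 h3 h4 => hx (.topTriangle i n ⟨h1, h2⟩ h3 h4)
  have hdiag : ∀ i n, 1 < i → i ≤ d → i ≤ n → n + d < N + i →
      entry x i n ≤ entry x (i - 1) (n - 1) := fun i n h1 h2 h3 h4 =>
    hx (.diagonal i n ⟨h1, h2⟩ ⟨h3, h4⟩)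
  have hnonneg : ∀ t, t < d → 0 ≤ entry x (d - t) (d - t) := by
    intro t
    induction t with
    | zero => exact fun _ => hx .lowerBound
    | succ t ih =>
      intro ht
      refine (ih (by omega)).trans ((hdiag (d - t) (d - t) (by omega) (by omega) le_rfl
        (by omega)).trans_eq ?_)
      rw [Nat.sub_sub]
  have hle : ∀ i, 1 ≤ i → i ≤ d → entry x i (N + i - d - 1) ≤ N := by
    intro i hi
    induction i, hi using Nat.le_induction with
    | base =>
      intro _
      rw [show N + 1 - d - 1 = N - d by omega]
      exact hx .upperBound
    | succ i hi ih =>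
      intro hi'
      refine (hdiag (i + 1) (N + (i + 1) - d - 1) (by omega) hi' (by omega) (by omega)).trans ?_
      rw [show i + 1 - 1 = i by omega, show N + (i + 1) - d - 1 - 1 = N + i - d - 1 by omega]
      exact ih (by omega)
  refine ⟨fun i h1 h2 => hzero i 0 h1 h2 (by omega),
    fun i h1 h2 => htop i N h1 h2 le_rfl (by omega), fun n hn => ?_, fun i n h1 h2 h3 => ?_,
    fun i n h1 h2 h3 h4 => ?_⟩
  · rcases Nat.eq_zero_or_pos n with rfl | hn0
    · rw [Finset.sum_eq_zero fun i hi => ?_]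
      · simp
      · rw [Finset.mem_Icc] at hi
        exact hzero i 0 hi.1 hi.2 (by omega)
    · rcases hn.eq_or_lt with rfl | hnN
      · rw [Finset.sum_congr rfl fun i hi => ?_, Finset.sum_const, Nat.card_Icc, nsmul_eq_mul]
        · rfl
        · rw [Finset.mem_Icc] at hi
          exact htop i _ hi.1 hi.2 le_rfl (by omega)
      · exact hx (.columnSum n ⟨hn0, hnN⟩)
  · by_cases hni : n < i
    · rw [hzero i n h1 h2 hni]
      by_cases hni' : n + 1 < i
      · rw [hzero i (n + 1) h1 h2 hni']
      · obtain rfl : i = n + 1 := by omega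
        have := hnonneg (d - (n + 1)) (by omega)
        rwa [show d - (d - (n + 1)) = n + 1 by omega] at this
    · by_cases hin : n + d + 1 < N + i
      · exact hx (.horizontal i n ⟨h1, h2⟩ ⟨by omega, hin⟩)
      · rw [htop i (n + 1) h1 h2 (by omega) (by omega)]
        by_cases hin' : n + d + 1 = N + i
        · have := hle i h1 h2
          rwa [show N + i - d - 1 = n by omega] at this
        · rw [htop i n h1 h2 (by omega) (by omega)]
  · by_cases hni : n < i
    · rw [hzero i n (by omega) h2 hni, hzero (i - 1) (n - 1) (by omega) (by omega) (by omega)]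
    · by_cases hin : n + d < N + i
      · exact hdiag i n h1 h2 (by omega) hin
      · rw [htop i n (by omega) h2 h4 (by omega),
          htop (i - 1) (n - 1) (by omega) (by omega) (by omega) (by omega)]

/-- The two column sums nearest to a corner of the free region decide the exceptional inequalities
there: `λ_{1,1} = d` and `λ_{1,2} + λ_{2,2} = 2d`, so that
`λ_{2,2} ≤ λ_{2,3} ≤ λ_{1,2}` gives `λ_{2,2} ≤ d ≤ λ_{1,2}`; the other corner is similar. -/
lemma holds_of_forall_not_isExceptional (hd : 2 ≤ d) (hdN : d + 2 ≤ N) (hN : 5 ≤ N)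
    {x : Matrix (Fin d) (Fin (N + 1)) ℝ}
    (hx : ∀ c : Condition N d, ¬ c.IsExceptional → c.Holds x) (c : Condition N d) :
    c.Holds x := by
  have hzero : ∀ i n, 1 ≤ i → i ≤ d → n < i → entry x i n = 0 := fun i n h1 h2 h3 =>
    hx (.zeroTriangle i n ⟨h1, h2⟩ (by omega) h3) id
  have htop : ∀ i n, 1 ≤ i → i ≤ d → n ≤ N → i + N < n + d + 1 → entry x i n = N :=
    fun i n h1 h2 h3 h4 => hx (.topTriangle i n ⟨h1, h2⟩ h3 h4) id
  have hsum : ∀ n, 0 < n → n < N → ∑ i ∈ Finset.Icc 1 d, entry x i n = d * n :=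
    fun n h1 h2 => hx (.columnSum n ⟨h1, h2⟩) id
  have hsum' : ∀ n, 0 < n → n < N →
      ∑ i ∈ Finset.Icc 1 d, ((N : ℝ) - entry x i n) = d * (N - n) := fun n h1 h2 => by
    rw [Finset.sum_sub_distrib, hsum n h1 h2, Finset.sum_const, Nat.card_Icc, nsmul_eq_mul]
    simp only [Nat.add_sub_cancel]
    ring
  have e11 : entry x 1 1 = d := by
    have h := hsum 1 (by omega) (by omega)
    rw [Finset.sum_eq_single_of_mem 1 (by simp; omega) fun i hi hne => ?_] at h
    · simpa using h
    · rw [Finset.mem_Icc] at hi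
      exact hzero i 1 hi.1 hi.2 (by omega)
  have e2 : entry x 1 2 + entry x 2 2 = 2 * d := by
    have h := hsum 2 (by omega) (by omega)
    rw [← Finset.sum_subset (s₁ := {1, 2}) ?_ fun i hi hne => ?_] at h
    · rw [Finset.sum_pair (by omega)] at h
      rw [h]; push_cast; ring
    · intro i hi
      simp only [Finset.mem_insert, Finset.mem_singleton, Finset.mem_Icc] at hi ⊢
      omega
    · simp only [Finset.mem_insert, Finset.mem_singleton, Finset.mem_Icc] at hi hne
      exact hzero i 2 hi.1 hi.2 (by omega)
  have f1 : (N : ℝ) - entry x d (N - 1) = d := by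
    have h := hsum' (N - 1) (by omega) (by omega)
    rw [Finset.sum_eq_single_of_mem d (by simp; omega) fun i hi hne => ?_] at h
    · rw [h, Nat.cast_sub (by omega)]; push_cast; ring
    · rw [Finset.mem_Icc] at hi
      rw [htop i (N - 1) hi.1 hi.2 (by omega) (by omega), sub_self]
  have f2 : ((N : ℝ) - entry x (d - 1) (N - 2)) + (N - entry x d (N - 2)) = 2 * d := by
    have h := hsum' (N - 2) (by omega) (by omega)
    rw [← Finset.sum_subset (s₁ := {d - 1, d}) ?_ fun i hi hne => ?_] at h
    · rw [Finset.sum_pair (by omega)] at h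
      rw [h, Nat.cast_sub (by omega)]; push_cast; ring
    · intro i hi
      simp only [Finset.mem_insert, Finset.mem_singleton, Finset.mem_Icc] at hi ⊢
      omega
    · simp only [Finset.mem_insert, Finset.mem_singleton, Finset.mem_Icc] at hi hne
      rw [htop i (N - 2) hi.1 hi.2 (by omega) (by omega), sub_self]
  have g1 : entry x 2 2 ≤ entry x 1 2 := by
    -- only for `N = 4` would these two inequalities be exceptional themselves
    have h1 : entry x 2 2 ≤ entry x 2 3 :=
      hx (.horizontal 2 2 ⟨by omega, hd⟩ ⟨le_rfl, by omega⟩) (by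
        simp only [Condition.IsExceptional]; omega)
    have h2 : entry x 2 3 ≤ entry x 1 2 :=
      hx (.diagonal 2 3 ⟨by omega, hd⟩ ⟨by omega, by omega⟩) (by
        simp only [Condition.IsExceptional]; omega)
    exact h1.trans h2
  have g2 : entry x d (N - 2) ≤ entry x (d - 1) (N - 2) := by
    have h1 : entry x d (N - 2) ≤ entry x (d - 1) (N - 2 - 1) :=
      hx (.diagonal d (N - 2) ⟨by omega, le_rfl⟩ ⟨by omega, by omega⟩) (by
        simp only [Condition.IsExceptional]; omega)
    have h2 : entry x (d - 1) (N - 3) ≤ entry x (d - 1) (N - 3 + 1) :=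
      hx (.horizontal (d - 1) (N - 3) ⟨by omega, by omega⟩ ⟨by omega, by omega⟩) (by
        simp only [Condition.IsExceptional]; omega)
    rw [show N - 2 - 1 = N - 3 by omega] at h1
    rw [show N - 3 + 1 = N - 2 by omega] at h2
    exact h1.trans h2
  by_cases hc : c.IsExceptional
  · cases c with
    | horizontal i n hi hn =>
      simp only [Condition.IsExceptional] at hc
      simp only [Condition.Holds]
      rcases hc with ⟨rfl, rfl⟩ | ⟨rfl, rfl⟩
      · linarith
      · rw [show N - 2 + 1 = N - 1 by omega]
        linarith
    | diagonal i n hi hn =>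
      simp only [Condition.IsExceptional] at hc
      simp only [Condition.Holds]
      rcases hc with ⟨rfl, rfl⟩ | ⟨rfl, rfl⟩
      · linarith
      · rw [show N - 1 - 1 = N - 2 by omega]
        linarith
    | _ => exact hc.elim
  · exact hx c hc

end Equivalence

/-! ### Violating a single equation or interior inequality -/

section Violation

variable {N d : ℕ}

/-- The indicator of row `a`. -/
def ind (a i : ℕ) : ℝ := if i = a then 1 else 0

lemma sum_ind {a : ℕ} (h1 : 1 ≤ a) (h2 : a ≤ d) : ∑ i ∈ Finset.Icc 1 d, ind a i = 1 := by
  simp [ind, Finset.sum_ite_eq', h1, h2]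

namespace Condition

/-- A perturbation of a single column by entries in `[-1, 1]` preserves all inequalities. -/
lemma formEntries_single_le {c : Condition N d} (hc : c.IsIneq) (n : ℕ) (f : ℕ → ℝ)
    (hf : ∀ i, |f i| ≤ 1) : c.formEntries (fun i m => if m = n then f i else 0) ≤ 1 := by
  have hle : ∀ i, f i ≤ 1 := fun i => (abs_le.1 (hf i)).2
  have hge : ∀ i, -f i ≤ 1 := fun i => by linarith [(abs_le.1 (hf i)).1]
  cases c with
  | horizontal i m hi hm =>
    simp only [formEntries]
    split_ifs <;> first | omega | (norm_num; try first | exact hle _ | linarith [hge i])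
  | diagonal i m hi hm =>
    simp only [formEntries]
    split_ifs <;> first | omega | (norm_num; try first | exact hle _ | linarith [hge (i - 1)])
  | lowerBound => simp only [formEntries]; split_ifs <;> first | exact hge _ | norm_num
  | upperBound => simp only [formEntries]; split_ifs <;> first | exact hle _ | norm_num
  | _ => exact hc.elim

/-- Every equation can be violated alone: for a column sum, change a free entry of the centre in that
column; for an entry `0` or `N`, change this entry and restore the column sum at a free entry of
the column, if there is one (there is none in the columns `0` and `N`). -/
lemma exists_violation_of_not_isIneq (hd : 2 ≤ d) (hdN : d + 2 ≤ N) {c : Condition N d}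
    (hc : ¬ c.IsIneq) :
    ∃ x : Matrix (Fin d) (Fin (N + 1)) ℝ, ¬ c.Holds x ∧ ∀ c' : Condition N d, c' ≠ c →
      c'.Holds x := by
  -- a column perturbation violating `c` and no other equation is enough
  suffices h : ∃ (n : ℕ) (f : ℕ → ℝ), (∀ i, |f i| ≤ 1) ∧
      c.formEntries (fun i m => if m = n then f i else 0) ≠ 0 ∧
      ∀ c' : Condition N d, c' ≠ c → ¬ c'.IsIneq →
        c'.formEntries (fun i m => if m = n then f i else 0) = 0 by
    obtain ⟨n, f, hf, h1, h2⟩ := h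
    refine ⟨perturb N d fun i m => if m = n then f i else 0, ?_, fun c' hc' => ?_⟩
    · rwa [holds_perturb_iff_eq (by omega) (by omega) hc]
    · by_cases h : c'.IsIneq
      · rw [holds_perturb_iff_le (by omega) (by omega) h]
        exact formEntries_single_le h n f hf
      · rw [holds_perturb_iff_eq (by omega) (by omega) h]
        exact h2 c' hc' h
  -- the entry `(min n d, n)` is free for `0 < n < N`
  have hcell : ∀ i n, 1 ≤ i → i ≤ d → (n < i ∨ i + N < n + d + 1) →
      ∃ f : ℕ → ℝ, (∀ j, |f j| ≤ 1) ∧ f i ≠ 0 ∧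
        (∀ j, j ≠ i → n < j ∨ j + N < n + d + 1 → 1 ≤ j → j ≤ d → f j = 0) ∧
        (0 < n → n < N → ∑ j ∈ Finset.Icc 1 d, f j = 0) := by
    intro i n h1 h2 h3
    by_cases hn : 0 < n ∧ n < N
    · have hne : i ≠ min n d := by omega
      refine ⟨fun j => ind i j - ind (min n d) j, fun j => ?_, ?_, fun j hj hj' h4 h5 => ?_,
        fun _ _ => ?_⟩
      · simp only [ind]
        split_ifs <;> norm_num
      · simp [ind, hne]
      · have : j ≠ min n d := by omega
        simp [ind, hj, this]
      · rw [Finset.sum_sub_distrib, sum_ind h1 h2, sum_ind (by omega) (by omega), sub_self]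
    · refine ⟨ind i, fun j => ?_, ?_, fun j hj _ _ _ => ?_, fun h4 h5 => (hn ⟨h4, h5⟩).elim⟩
      · simp only [ind]
        split_ifs <;> norm_num
      · simp [ind]
      · simp [ind, hj]
  cases c with
  | zeroTriangle i n hi hn h =>
    obtain ⟨f, hf, h1, h2, h3⟩ := hcell i n hi.1 hi.2 (Or.inl h)
    refine ⟨n, f, hf, by simpa [formEntries] using h1, fun c' hne hc' => ?_⟩
    cases c' with
    | zeroTriangle j m hj hm h' =>
      simp only [formEntries]
      split_ifs with hmn
      · subst hmn
        refine h2 j (fun h4 => ?_) (Or.inl h') hj.1 hj.2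
        subst h4
        exact hne rfl
      · rfl
    | topTriangle j m hj hm h' =>
      simp only [formEntries]
      split_ifs with hmn
      · subst hmn
        exact h2 j (by omega) (Or.inr h') hj.1 hj.2
      · rfl
    | columnSum m hm =>
      simp only [formEntries]
      split_ifs with hmn
      · subst hmn
        exact h3 hm.1 hm.2
      · simp
    | _ => exact (hc' trivial).elim
  | topTriangle i n hi hn h =>
    obtain ⟨f, hf, h1, h2, h3⟩ := hcell i n hi.1 hi.2 (Or.inr h)
    refine ⟨n, f, hf, by simpa [formEntries] using h1, fun c' hne hc' => ?_⟩
    cases c' with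
    | zeroTriangle j m hj hm h' =>
      simp only [formEntries]
      split_ifs with hmn
      · subst hmn
        exact h2 j (by omega) (Or.inl h') hj.1 hj.2
      · rfl
    | topTriangle j m hj hm h' =>
      simp only [formEntries]
      split_ifs with hmn
      · subst hmn
        refine h2 j (fun h4 => ?_) (Or.inr h') hj.1 hj.2
        subst h4
        exact hne rfl
      · rfl
    | columnSum m hm =>
      simp only [formEntries]
      split_ifs with hmn
      · subst hmn
        exact h3 hm.1 hm.2
      · simp
    | _ => exact (hc' trivial).elim
  | columnSum n hn =>
    refine ⟨n, ind (min n d), fun j => ?_, ?_, fun c' hne hc' => ?_⟩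
    · simp only [ind]
      split_ifs <;> norm_num
    · simp only [formEntries, if_true]
      rw [sum_ind (by omega) (by omega)]
      norm_num
    · cases c' with
      | zeroTriangle j m hj hm h' =>
        simp only [formEntries, ind]
        split_ifs <;> first | omega | rfl
      | topTriangle j m hj hm h' =>
        simp only [formEntries, ind]
        split_ifs <;> first | omega | rfl
      | columnSum m hm =>
        simp only [formEntries]
        split_ifs with hmn
        · subst hmn
          exact (hne rfl).elim
        · simp
      | _ => exact (hc' trivial).elim
  | _ => exact (hc trivial).elim

/-- The perturbation with `+1` in the rows `a`, `b` and `-1` in the rows `a'`, `b'` of the columns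
`n`, `n + 1` respectively. -/
def quad (n a a' b b' i m : ℕ) : ℝ :=
  if m = n then ind a i - ind a' i else if m = n + 1 then ind b i - ind b' i else 0

/-- The inequalities between two consecutive columns compare consecutive entries of a zigzag path.
Consequently the perturbation `quad` violates only those between an entry `+1` and the entry `-1`
following it on the path. -/
lemma holds_perturb_quad (hd : 2 ≤ d) (hdN : d + 2 ≤ N) {n a a' b b' : ℕ}
    (ha : a ≠ a') (hb : b ≠ b')
    (ha0 : 1 ≤ a ∧ a ≤ d ∧ a ≤ n ∧ n + d < N + a)
    (ha0' : 1 ≤ a' ∧ a' ≤ d ∧ a' ≤ n ∧ n + d < N + a')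
    (hb0 : 1 ≤ b ∧ b ≤ d ∧ b ≤ n + 1 ∧ n + 1 + d < N + b)
    (hb0' : 1 ≤ b' ∧ b' ≤ d ∧ b' ≤ n + 1 ∧ n + 1 + d < N + b') (c : Condition N d)
    (h1 : ∀ i m hi hm, c = .horizontal i m hi hm → ¬ (m = n ∧ i = a ∧ i = b'))
    (h2 : ∀ i m hi hm, c = .diagonal i m hi hm → ¬ (m = n + 1 ∧ i = b ∧ i = a' + 1)) :
    c.Holds (perturb N d (quad n a a' b b')) := by
  cases c with
  | zeroTriangle i m hi hm h =>
    rw [holds_perturb_iff_eq (by omega) (by omega) id]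
    simp only [formEntries, quad, ind]
    split_ifs <;> first | omega | norm_num
  | topTriangle i m hi hm h =>
    rw [holds_perturb_iff_eq (by omega) (by omega) id]
    simp only [formEntries, quad, ind]
    split_ifs <;> first | omega | norm_num
  | columnSum m hm =>
    rw [holds_perturb_iff_eq (by omega) (by omega) id]
    simp only [formEntries, quad]
    split_ifs
    · rw [Finset.sum_sub_distrib, sum_ind ha0.1 ha0.2.1, sum_ind ha0'.1 ha0'.2.1, sub_self]
    · rw [Finset.sum_sub_distrib, sum_ind hb0.1 hb0.2.1, sum_ind hb0'.1 hb0'.2.1, sub_self]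
    · simp
  | horizontal i m hi hm =>
    have h1' := h1 i m hi hm rfl
    rw [holds_perturb_iff_le (by omega) (by omega) (by trivial)]
    simp only [formEntries, quad, ind]
    split_ifs <;> first | omega | norm_num
  | diagonal i m hi hm =>
    have h2' := h2 i m hi hm rfl
    rw [holds_perturb_iff_le (by omega) (by omega) (by trivial)]
    simp only [formEntries, quad, ind]
    split_ifs <;> first | omega | norm_num
  | lowerBound =>
    rw [holds_perturb_iff_le (by omega) (by omega) (by trivial)]
    simp only [formEntries, quad, ind]
    split_ifs <;> first | omega | norm_num
  | upperBound =>
    rw [holds_perturb_iff_le (by omega) (by omega) (by trivial)]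
    simp only [formEntries, quad, ind]
    split_ifs <;> first | omega | norm_num

/-- The inequality from entry `(i, n)`, with `+1`, to entry `(i, n + 1)`, with `-1`, is violated
alone if these are completed to one of the patterns `+ + - -`, `+ - - +` or `- + + -` of consecutive
entries on the path. -/
lemma exists_violation_horizontal (hd : 2 ≤ d) (hdN : d + 2 ≤ N) {i n : ℕ} (hi : 1 ≤ i ∧ i ≤ d)
    (hn : i ≤ n ∧ n + d + 1 < N + i)
    (hex : ¬ (horizontal i n hi hn : Condition N d).IsExceptional) :
    ∃ x : Matrix (Fin d) (Fin (N + 1)) ℝ, ¬ (horizontal i n hi hn : Condition N d).Holds x ∧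
      ∀ c' : Condition N d, c' ≠ horizontal i n hi hn → c'.Holds x := by
  simp only [IsExceptional] at hex
  obtain ⟨a', b, ha', ha0', hb, hb0, hab⟩ : ∃ a' b, i ≠ a' ∧
      (1 ≤ a' ∧ a' ≤ d ∧ a' ≤ n ∧ n + d < N + a') ∧ b ≠ i ∧
      (1 ≤ b ∧ b ≤ d ∧ b ≤ n + 1 ∧ n + 1 + d < N + b) ∧ b ≠ a' + 1 := by
    by_cases h1 : 2 ≤ i
    · by_cases h2 : n + d < N + (i - 1)
      · by_cases h3 : i + 1 ≤ d
        · exact ⟨i - 1, i + 1, by omega⟩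
        · exact ⟨i - 1, i - 1, by omega⟩
      · exact ⟨i + 1, i + 1, by omega⟩
    · exact ⟨i + 1, i + 1, by omega⟩
  refine ⟨perturb N d (quad n i a' b i), ?_, fun c' hne => ?_⟩
  · rw [holds_perturb_iff_le (by omega) (by omega) (by trivial)]
    simp only [formEntries, quad, ind, if_true]
    rw [if_neg (by omega : ¬ i = a'), if_neg (by omega : ¬ n + 1 = n), if_neg (Ne.symm hb)]
    norm_num
  · refine holds_perturb_quad hd hdN ha' hb ⟨hi.1, hi.2, hn.1, by omega⟩ ha0' hb0
      ⟨hi.1, hi.2, by omega, by omega⟩ c' ?_ ?_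
    · rintro j m hj hm rfl ⟨rfl, rfl, -⟩
      exact hne rfl
    · rintro j m hj hm rfl
      omega

/-- The same as for horizontal inequalities, for the step from `(i, n)` to `(i - 1, n - 1)`. -/
lemma exists_violation_diagonal (hd : 2 ≤ d) (hdN : d + 2 ≤ N) {i n : ℕ} (hi : 1 < i ∧ i ≤ d)
    (hn : i ≤ n ∧ n + d < N + i)
    (hex : ¬ (diagonal i n hi hn : Condition N d).IsExceptional) :
    ∃ x : Matrix (Fin d) (Fin (N + 1)) ℝ, ¬ (diagonal i n hi hn : Condition N d).Holds x ∧
      ∀ c' : Condition N d, c' ≠ diagonal i n hi hn → c'.Holds x := by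
  simp only [IsExceptional] at hex
  obtain ⟨n, rfl⟩ : ∃ m, n = m + 1 := ⟨n - 1, by omega⟩
  obtain ⟨a, b', ha, ha0, hb, hb0', hab⟩ : ∃ a b', a ≠ i - 1 ∧
      (1 ≤ a ∧ a ≤ d ∧ a ≤ n ∧ n + d < N + a) ∧ i ≠ b' ∧
      (1 ≤ b' ∧ b' ≤ d ∧ b' ≤ n + 1 ∧ n + 1 + d < N + b') ∧ a ≠ b' := by
    by_cases h1 : n + 1 + d < N + (i - 1)
    · by_cases h2 : i ≤ n
      · exact ⟨i, i - 1, by omega⟩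
      · exact ⟨i - 2, i - 1, by omega⟩
    · exact ⟨i, i + 1, by omega⟩
  refine ⟨perturb N d (quad n a (i - 1) i b'), ?_, fun c' hne => ?_⟩
  · rw [holds_perturb_iff_le (by omega) (by omega) (by trivial)]
    simp only [formEntries, quad, ind, if_true, Nat.add_sub_cancel]
    rw [if_neg (by omega : ¬ n + 1 = n), if_neg (by omega : ¬ i = b'),
      if_neg (by omega : ¬ i - 1 = a)]
    norm_num
  · refine holds_perturb_quad hd hdN ha hb ha0 ⟨by omega, by omega, by omega, by omega⟩
      ⟨by omega, by omega, hn.1, by omega⟩ hb0' c' ?_ ?_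
    · rintro j m hj hm rfl
      omega
    · rintro j m hj hm rfl ⟨rfl, rfl, -⟩
      exact hne rfl

end Condition

end Violation

/-! ### Violating a single bound -/

section Bounds

variable {N d : ℕ}

/-- The perturbation whose column `n` is `σ` times `2` in row `a` and `-1` in rows `r` and `s` (so
`-2` if `r = s`), and whose column `e` is `1` in row `t` and `-1` in row `w`, the latter part being
void if `e = n`. -/
def starEntries (σ : ℝ) (n a r s e t w i m : ℕ) : ℝ :=
  if m = n then σ * (2 * ind a i - ind r i - ind s i) else if m = e then ind t i - ind w i else 0

namespace Condition

lemma formEntries_starEntries {c : Condition N d} (hc : ¬ c.IsIneq) (σ : ℝ)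
    {n a r s e t w : ℕ}
    (ha : 1 ≤ a ∧ a ≤ d ∧ a ≤ n ∧ n + d < N + a) (hr : 1 ≤ r ∧ r ≤ d ∧ r ≤ n ∧ n + d < N + r)
    (hs : 1 ≤ s ∧ s ≤ d ∧ s ≤ n ∧ n + d < N + s) (ht : 1 ≤ t ∧ t ≤ d ∧ t ≤ e ∧ e + d < N + t)
    (hw : 1 ≤ w ∧ w ≤ d ∧ w ≤ e ∧ e + d < N + w) :
    c.formEntries (starEntries σ n a r s e t w) = 0 := by
  cases c with
  | zeroTriangle i m hi hm h =>
    simp only [formEntries, starEntries, ind]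
    split_ifs <;> first | omega | norm_num
  | topTriangle i m hi hm h =>
    simp only [formEntries, starEntries, ind]
    split_ifs <;> first | omega | norm_num
  | columnSum m hm =>
    simp only [formEntries, starEntries]
    split_ifs
    · rw [← Finset.mul_sum, Finset.sum_sub_distrib, Finset.sum_sub_distrib, ← Finset.mul_sum,
        sum_ind ha.1 ha.2.1, sum_ind hr.1 hr.2.1, sum_ind hs.1 hs.2.1]
      norm_num
    · rw [Finset.sum_sub_distrib, sum_ind ht.1 ht.2.1, sum_ind hw.1 hw.2.1, sub_self]
    · simp
  | _ => exact (hc trivial).elim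

lemma exists_violation_of_formEntries (hd : 1 ≤ d) (hdN : d + 1 ≤ N) {c : Condition N d}
    (hc : c.IsIneq) (u : ℕ → ℕ → ℝ) (hu : ∀ c' : Condition N d, ¬ c'.IsIneq → c'.formEntries u = 0)
    (hcu : 1 < c.formEntries u)
    (hcu' : ∀ c' : Condition N d, c' ≠ c → c'.IsIneq → c'.formEntries u ≤ 1) :
    ∃ x : Matrix (Fin d) (Fin (N + 1)) ℝ, ¬ c.Holds x ∧
      ∀ c' : Condition N d, c' ≠ c → c'.Holds x := by
  refine ⟨perturb N d u, ?_, fun c' hc' => ?_⟩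
  · rw [holds_perturb_iff_le hd hdN hc]
    exact not_le.2 hcu
  · by_cases h : c'.IsIneq
    · exact (holds_perturb_iff_le hd hdN h u).2 (hcu' c' hc' h)
    · exact (holds_perturb_iff_eq hd hdN h u).2 (hu c' h)

/-- For `d ≥ 3` and `N - d ≥ 3`, balancing `-2` at `(d, d)` by two entries `+1` of the same column
violates `lowerBound` alone.  If `d = 2` or `N - d = 2`, only one entry `+2` can balance it, and the
steps that this entry would violate are repaired in the next column (`d = 2`) or in the previous
one (`N - d = 2`). -/
lemma exists_violation_lowerBound (hd : 2 ≤ d) (hdN : d + 2 ≤ N) (hN : 5 ≤ N) :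
    ∃ x : Matrix (Fin d) (Fin (N + 1)) ℝ, ¬ (lowerBound : Condition N d).Holds x ∧
      ∀ c' : Condition N d, c' ≠ lowerBound → c'.Holds x := by
  by_cases h2 : d = 2
  · subst h2
    refine exists_violation_of_formEntries (by omega) (by omega) (by trivial)
      (starEntries (-1) 2 2 1 1 3 1 2)
      (fun c' h => formEntries_starEntries h _ (by omega) (by omega) (by omega) (by omega)
        (by omega)) ?_ fun c' hc' h => ?_
    · norm_num [formEntries, starEntries, ind]
    · cases c' <;> first | exact h.elim | exact (hc' rfl).elim | skip
      all_goals simp only [formEntries, starEntries, ind]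
      all_goals split_ifs <;> first | omega | norm_num
  by_cases h3 : N = d + 2
  · subst h3
    refine exists_violation_of_formEntries (by omega) (by omega) (by trivial)
      (starEntries (-1) d d (d - 1) (d - 1) (d - 1) (d - 2) (d - 1))
      (fun c' h => formEntries_starEntries h _ (by omega) (by omega) (by omega) (by omega)
        (by omega)) ?_ fun c' hc' h => ?_
    · simp only [formEntries, starEntries, ind]
      split_ifs <;> first | omega | norm_num
    · cases c' <;> first | exact h.elim | exact (hc' rfl).elim | skip
      all_goals simp only [formEntries, starEntries, ind]
      all_goals split_ifs <;> first | omega | norm_num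
  · refine exists_violation_of_formEntries (by omega) (by omega) (by trivial)
      (starEntries (-1) d d (d - 1) (d - 2) d d d)
      (fun c' h => formEntries_starEntries h _ (by omega) (by omega) (by omega) (by omega)
        (by omega)) ?_ fun c' hc' h => ?_
    · simp only [formEntries, starEntries, ind]
      split_ifs <;> first | omega | norm_num
    · cases c' <;> first | exact h.elim | exact (hc' rfl).elim | skip
      all_goals simp only [formEntries, starEntries, ind]
      all_goals split_ifs <;> first | omega | norm_num

/-- The perturbations are those for `lowerBound`, rotated by `(i, n) ↦ (d + 1 - i, N - n)` and
negated. -/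
lemma exists_violation_upperBound (hd : 2 ≤ d) (hdN : d + 2 ≤ N) (hN : 5 ≤ N) :
    ∃ x : Matrix (Fin d) (Fin (N + 1)) ℝ, ¬ (upperBound : Condition N d).Holds x ∧
      ∀ c' : Condition N d, c' ≠ upperBound → c'.Holds x := by
  by_cases h2 : d = 2
  · subst h2
    refine exists_violation_of_formEntries (by omega) (by omega) (by trivial)
      (starEntries 1 (N - 2) 1 2 2 (N - 3) 1 2)
      (fun c' h => formEntries_starEntries h _ (by omega) (by omega) (by omega) (by omega)
        (by omega)) ?_ fun c' hc' h => ?_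
    · norm_num [formEntries, starEntries, ind]
    · cases c' <;> first | exact h.elim | exact (hc' rfl).elim | skip
      all_goals simp only [formEntries, starEntries, ind]
      all_goals split_ifs <;> first | omega | norm_num
  by_cases h3 : N = d + 2
  · subst h3
    refine exists_violation_of_formEntries (by omega) (by omega) (by trivial)
      (starEntries 1 2 1 2 2 3 2 3)
      (fun c' h => formEntries_starEntries h _ (by omega) (by omega) (by omega) (by omega)
        (by omega)) ?_ fun c' hc' h => ?_
    · simp only [formEntries, starEntries, ind]
      split_ifs <;> first | omega | norm_num
    · cases c' <;> first | exact h.elim | exact (hc' rfl).elim | skip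
      all_goals simp only [formEntries, starEntries, ind]
      all_goals split_ifs <;> first | omega | norm_num
  · refine exists_violation_of_formEntries (by omega) (by omega) (by trivial)
      (starEntries 1 (N - d) 1 2 3 (N - d) 1 1)
      (fun c' h => formEntries_starEntries h _ (by omega) (by omega) (by omega) (by omega)
        (by omega)) ?_ fun c' hc' h => ?_
    · simp only [formEntries, starEntries, ind]
      split_ifs <;> first | omega | norm_num
    · cases c' <;> first | exact h.elim | exact (hc' rfl).elim | skip
      all_goals simp only [formEntries, starEntries, ind]
      all_goals split_ifs <;> first | omega | norm_num

lemma exists_violation (hd : 2 ≤ d) (hdN : d + 2 ≤ N) (hN : 5 ≤ N) {c : Condition N d}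
    (hc : ¬ c.IsExceptional) :
    ∃ x : Matrix (Fin d) (Fin (N + 1)) ℝ, ¬ c.Holds x ∧
      ∀ c' : Condition N d, c' ≠ c → c'.Holds x := by
  cases c with
  | horizontal i n hi hn => exact exists_violation_horizontal hd hdN hi hn hc
  | diagonal i n hi hn => exact exists_violation_diagonal hd hdN hi hn hc
  | lowerBound => exact exists_violation_lowerBound hd hdN hN
  | upperBound => exact exists_violation_upperBound hd hdN hN
  | _ => exact exists_violation_of_not_isIneq hd hdN id

end Condition

end Bounds

/-! ### Counting the facets -/

section Counting

variable {N d : ℕ}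

/-- The affine subspace cut out by the equations of the reduced description. -/
noncomputable def equationSpace (N d : ℕ) :
    AffineSubspace ℝ (Matrix (Fin d) (Fin (N + 1)) ℝ) where
  carrier := {x | ∀ c : Condition N d, ¬ c.IsIneq → c.form x = c.bound}
  smul_vsub_vadd_mem' t _ _ _ hx hy hz c hc := by
    simp [hx c hc, hy c hc, hz c hc]

lemma mem_equationSpace {x : Matrix (Fin d) (Fin (N + 1)) ℝ} :
    x ∈ equationSpace N d ↔ ∀ c : Condition N d, ¬ c.IsIneq → c.Holds x :=
  forall₂_congr fun c hc => (c.holds_iff_eq hc x).symm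

/-- The number of facets is the number of inequalities in any non-redundant selection that describes
the eigensteps together with the equations. -/
lemma ncard_isFacet_eigensteps (hd : 1 ≤ d) (hdN : d + 1 ≤ N) (S : Set (Condition N d))
    (hfin : S.Finite) (hS : ∀ c ∈ S, c.IsIneq)
    (hdesc : eigensteps N d = {x | ∀ c : Condition N d, ¬ c.IsIneq ∨ c ∈ S → c.Holds x})
    (hviol : ∀ c ∈ S, ∃ x : Matrix (Fin d) (Fin (N + 1)) ℝ, ¬ c.Holds x ∧
      ∀ c' : Condition N d, ¬ c'.IsIneq ∨ c' ∈ S → c' ≠ c → c'.Holds x) :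
    {F | IsFacet (eigensteps N d) F}.ncard = S.ncard := by
  have : Finite S := hfin
  have hpoly : eigensteps N d =
      polyhedron (equationSpace N d) (fun c : S => c.1.form) (fun c : S => c.1.bound) := by
    rw [hdesc]
    ext x
    constructor
    · intro h
      exact ⟨mem_equationSpace.2 fun c hc => h c (Or.inl hc),
        fun c => (c.1.holds_iff_le (hS _ c.2) x).1 (h c.1 (Or.inr c.2))⟩
    · rintro ⟨h1, h2⟩ c (hc | hc)
      · exact mem_equationSpace.1 h1 c hc
      · exact (c.holds_iff_le (hS _ hc) x).2 (h2 ⟨c, hc⟩)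
  rw [hpoly, ncard_isFacet_polyhedron _ _ _ (ofEntries N d (centreEntries N d)),
    Nat.card_coe_set_eq]
  · exact fun c hc => (form_centre hd hdN c).2 hc
  · intro c
    have := (form_centre hd hdN c.1).1 (hS _ c.2)
    simp only [this]
    linarith
  · intro c
    obtain ⟨x, hx, hx'⟩ := hviol c.1 c.2
    refine ⟨x, mem_equationSpace.2 fun c' hc' => hx' c' (Or.inl hc') ?_, ?_, fun c' hc' => ?_⟩
    · rintro rfl
      exact hc' (hS _ c.2)
    · rwa [Condition.holds_iff_le (hS _ c.2), not_le] at hx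
    · rw [← Condition.holds_iff_le (hS _ c'.2)]
      exact hx' c'.1 (Or.inr c'.2) fun h => hc' (Subtype.ext h)

namespace Condition

lemma horizontal_congr {i i' n n' : ℕ} (h1 : i = i') (h2 : n = n') (hi : 1 ≤ i ∧ i ≤ d)
    (hn : i ≤ n ∧ n + d + 1 < N + i) (hi' : 1 ≤ i' ∧ i' ≤ d)
    (hn' : i' ≤ n' ∧ n' + d + 1 < N + i') :
    (horizontal i n hi hn : Condition N d) = horizontal i' n' hi' hn' := by
  subst h1 h2; rfl

lemma diagonal_congr {i i' n n' : ℕ} (h1 : i = i') (h2 : n = n') (hi : 1 < i ∧ i ≤ d)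
    (hn : i ≤ n ∧ n + d < N + i) (hi' : 1 < i' ∧ i' ≤ d) (hn' : i' ≤ n' ∧ n' + d < N + i') :
    (diagonal i n hi hn : Condition N d) = diagonal i' n' hi' hn' := by
  subst h1 h2; rfl

/-- The inequalities, parametrised by row and position in the row. -/
def ofIndex (N d : ℕ) :
    (Fin d × Fin (N - d - 1)) ⊕ (Fin (d - 1) × Fin (N - d)) ⊕ Bool → Condition N d
  | .inl (a, j) => .horizontal (a + 1) (a + 1 + j) ⟨by omega, by omega⟩ ⟨by omega, by omega⟩
  | .inr (.inl (a, j)) => .diagonal (a + 2) (a + 2 + j) ⟨by omega, by omega⟩ ⟨by omega, by omega⟩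
  | .inr (.inr false) => .lowerBound
  | .inr (.inr true) => .upperBound

lemma ofIndex_injective : Function.Injective (ofIndex N d) := by
  rintro (⟨a, j⟩ | ⟨a, j⟩ | _ | _) (⟨a', j'⟩ | ⟨a', j'⟩ | _ | _) h <;>
    simp only [ofIndex, reduceCtorEq, horizontal.injEq, diagonal.injEq] at h <;>
    first
    | rfl
    | (obtain ⟨h1, h2⟩ := h
       have e1 : a = a' := Fin.ext (by omega)
       have e2 : j = j' := Fin.ext (by omega)
       rw [e1, e2])

lemma range_ofIndex : Set.range (ofIndex N d) = {c | c.IsIneq} := by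
  ext c
  constructor
  · rintro ⟨(⟨a, j⟩ | ⟨a, j⟩ | _ | _), rfl⟩ <;> trivial
  · intro hc
    cases c with
    | horizontal i n hi hn =>
      exact ⟨.inl (⟨i - 1, by omega⟩, ⟨n - i, by omega⟩),
        horizontal_congr (by simp only []; omega) (by simp only []; omega) _ _ _ _⟩
    | diagonal i n hi hn =>
      exact ⟨.inr (.inl (⟨i - 2, by omega⟩, ⟨n - i, by omega⟩)),
        diagonal_congr (by simp only []; omega) (by simp only []; omega) _ _ _ _⟩
    | lowerBound => exact ⟨.inr (.inr false), rfl⟩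
    | upperBound => exact ⟨.inr (.inr true), rfl⟩
    | _ => exact hc.elim

lemma finite_isIneq : {c : Condition N d | c.IsIneq}.Finite :=
  range_ofIndex ▸ Set.finite_range _

lemma ncard_isIneq :
    {c : Condition N d | c.IsIneq}.ncard = d * (N - d - 1) + ((d - 1) * (N - d) + 2) := by
  rw [← range_ofIndex, ← Set.image_univ, Set.ncard_image_of_injective _ ofIndex_injective,
    Set.ncard_univ, Nat.card_eq_fintype_card]
  simp

lemma ncard_isExceptional (hd : 2 ≤ d) (hdN : d + 2 ≤ N) (hN : 5 ≤ N) :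
    {c : Condition N d | c.IsExceptional}.ncard = 4 := by
  have heq : {c : Condition N d | c.IsExceptional} =
      {.horizontal 1 1 ⟨le_rfl, by omega⟩ ⟨le_rfl, by omega⟩,
        .horizontal d (N - 2) ⟨by omega, le_rfl⟩ ⟨by omega, by omega⟩,
        .diagonal 2 2 ⟨by omega, hd⟩ ⟨le_rfl, by omega⟩,
        .diagonal d (N - 1) ⟨by omega, le_rfl⟩ ⟨by omega, by omega⟩} := by
    ext c
    cases c <;> simp [IsExceptional]
  rw [heq, Set.ncard_insert_of_notMem, Set.ncard_insert_of_notMem, Set.ncard_pair]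
  all_goals
    simp only [Set.mem_insert_iff, Set.mem_singleton_iff, horizontal.injEq, diagonal.injEq,
      reduceCtorEq, ne_eq, or_false, not_false_eq_true]
    try omega

lemma ncard_isIneq_and_not_isExceptional (hd : 2 ≤ d) (hdN : d + 2 ≤ N) (hN : 5 ≤ N) :
    ({c : Condition N d | c.IsIneq ∧ ¬ c.IsExceptional}.ncard : ℤ) =
      (d : ℤ) * ((N : ℤ) - d - 1) + ((N : ℤ) - d) * ((d : ℤ) - 1) - 2 := by
  have hsub : {c : Condition N d | c.IsExceptional} ⊆ {c | c.IsIneq} := fun c hc => by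
    cases c <;> first | exact hc.elim | trivial
  have h := Set.ncard_sdiff_add_ncard_of_subset hsub finite_isIneq
  rw [ncard_isExceptional hd hdN hN, ncard_isIneq] at h
  have h' : {c : Condition N d | c.IsIneq ∧ ¬ c.IsExceptional} =
      {c | c.IsIneq} \ {c | c.IsExceptional} := rfl
  rw [h']
  obtain ⟨k, rfl⟩ : ∃ k, N = d + 2 + k := Nat.exists_eq_add_of_le hdN
  obtain ⟨e, rfl⟩ : ∃ e, d = e + 2 := Nat.exists_eq_add_of_le' hd
  rw [show e + 2 + 2 + k - (e + 2) - 1 = k + 1 by omega, show e + 2 - 1 = e + 1 by omega,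
    show e + 2 + 2 + k - (e + 2) = k + 2 by omega] at h
  have h2 := congrArg (Nat.cast : ℕ → ℤ) h
  push_cast at h2 ⊢
  linarith

end Condition

/-- For `N = 4` and `d = 2` the only free parameter is `λ_{2,2}`: the column sums give
`λ_{1,1} = λ_{2,3} = 2` and `λ_{1,2} = 4 - λ_{2,2}`, so that the polytope is the segment
`0 ≤ λ_{2,2} ≤ 2`.  Every inequality is equivalent to one of these two. -/
lemma ncard_isFacet_eigensteps_four_two : {F | IsFacet (eigensteps 4 2) F}.ncard = 2 := by
  have hne : (Condition.lowerBound : Condition 4 2) ≠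
      .diagonal 2 2 ⟨by omega, by omega⟩ ⟨by omega, by omega⟩ := nofun
  refine Eq.trans (ncard_isFacet_eigensteps (by omega) (by omega) _ ?_ ?_ ?_ ?_)
    (Set.ncard_pair hne)
  · exact Set.toFinite _
  · rintro c (rfl | rfl) <;> trivial
  · refine Set.Subset.antisymm
      (fun x hx c _ => holds_of_mem_eigensteps (by omega) (by omega) hx c) fun x hx => ?_
    refine mem_eigensteps_of_holds (by omega) fun c => ?_
    by_cases hc : c.IsIneq
    · have hlow : 0 ≤ entry x 2 2 := hx .lowerBound (Or.inr (Or.inl rfl))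
      have hdiag : entry x 2 2 ≤ entry x 1 1 :=
        hx (.diagonal 2 2 ⟨by omega, by omega⟩ ⟨by omega, by omega⟩) (Or.inr (Or.inr rfl))
      have hzero : entry x 2 1 = 0 :=
        hx (.zeroTriangle 2 1 ⟨by omega, by omega⟩ (by omega) (by omega)) (Or.inl id)
      have htop : entry x 1 3 = ((4 : ℕ) : ℝ) :=
        hx (.topTriangle 1 3 ⟨by omega, by omega⟩ (by omega) (by omega)) (Or.inl id)
      have hsum : ∀ n, 0 < n → n < 4 → entry x 1 n + entry x 2 n = 2 * n := fun n h1 h2 => by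
        have := hx (.columnSum n ⟨h1, h2⟩) (Or.inl id)
        simpa [Condition.Holds, Finset.sum_Icc_succ_top] using this
      have h1 := hsum 1 (by omega) (by omega)
      have h2 := hsum 2 (by omega) (by omega)
      have h3 := hsum 3 (by omega) (by omega)
      push_cast at h1 h2 h3 htop
      cases c with
      | horizontal i n hi hn =>
        obtain ⟨rfl, rfl⟩ | ⟨rfl, rfl⟩ : i = 1 ∧ n = 1 ∨ i = 2 ∧ n = 2 := by omega
        all_goals
          simp only [Condition.Holds, Nat.reduceAdd]
          linarith
      | diagonal i n hi hn =>
        obtain ⟨rfl, rfl⟩ | ⟨rfl, rfl⟩ : i = 2 ∧ n = 2 ∨ i = 2 ∧ n = 3 := by omega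
        all_goals
          simp only [Condition.Holds, Nat.reduceSub]
          linarith
      | lowerBound => exact hlow
      | upperBound =>
        simp only [Condition.Holds, Nat.reduceSub]
        push_cast
        linarith
      | _ => exact hc.elim
    · exact hx c (Or.inl hc)
  · -- move `λ_{2,2}` from its central value `1` to `-1` or to `3`
    have hviol : ∀ σ : ℝ, ∀ c ∈ ({.lowerBound, .diagonal 2 2 ⟨by omega, by omega⟩
        ⟨by omega, by omega⟩} : Set (Condition 4 2)),
        (c.Holds (perturb 4 2 (starEntries σ 2 1 2 2 2 1 1)) ↔ c.formEntries _ ≤ 1) :=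
      fun σ c hc => Condition.holds_perturb_iff_le (by omega) (by omega)
        (by rcases hc with rfl | rfl <;> trivial) _
    have heq : ∀ σ : ℝ, ∀ c : Condition 4 2, ¬ c.IsIneq →
        c.Holds (perturb 4 2 (starEntries σ 2 1 2 2 2 1 1)) := fun σ c hc => by
      rw [Condition.holds_perturb_iff_eq (by omega) (by omega) hc]
      exact Condition.formEntries_starEntries hc σ (by omega) (by omega) (by omega) (by omega)
        (by omega)
    rintro c (rfl | rfl)
    · refine ⟨perturb 4 2 (starEntries 1 2 1 2 2 2 1 1), ?_, ?_⟩
      · rw [hviol 1 _ (by simp)]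
        norm_num [Condition.formEntries, starEntries, ind]
      · rintro c (hc | rfl | rfl) hne
        · exact heq _ c hc
        · exact (hne rfl).elim
        · rw [hviol 1 _ (by simp)]
          norm_num [Condition.formEntries, starEntries, ind]
    · refine ⟨perturb 4 2 (starEntries (-1) 2 1 2 2 2 1 1), ?_, ?_⟩
      · rw [hviol (-1) _ (by simp)]
        norm_num [Condition.formEntries, starEntries, ind]
      · rintro c (hc | rfl | rfl) hne
        · exact heq _ c hc
        · rw [hviol (-1) _ (by simp)]
          norm_num [Condition.formEntries, starEntries, ind]
        · exact (hne rfl).elim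

end Counting

theorem mainTheorem2 (N d : ℕ) (hd : 2 ≤ d) (hdN : d + 2 ≤ N) :
    (({F | IsFacet (eigensteps N d) F}.ncard : ℕ) : ℤ) =
        (d : ℤ) * ((N : ℤ) - d - 1) + ((N : ℤ) - d) * ((d : ℤ) - 1) - 2 ∧
    (5 ≤ N →
      eigensteps N d = {x | ∀ c : Condition N d, ¬ c.IsExceptional → c.Holds x} ∧
      ∀ c : Condition N d, ¬ c.IsExceptional →
        ∃ x : Matrix (Fin d) (Fin (N + 1)) ℝ, ¬ c.Holds x ∧
          ∀ c' : Condition N d, c' ≠ c → c'.Holds x) := by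
  have hdesc : 5 ≤ N →
      eigensteps N d = {x | ∀ c : Condition N d, ¬ c.IsExceptional → c.Holds x} := fun hN =>
    Set.Subset.antisymm
      (fun x hx c _ => holds_of_mem_eigensteps (by omega) (by omega) hx c)
      fun x hx => mem_eigensteps_of_holds (by omega)
        (holds_of_forall_not_isExceptional hd hdN hN hx)
  refine ⟨?_, fun hN => ⟨hdesc hN, fun c hc => Condition.exists_violation hd hdN hN hc⟩⟩
  by_cases hN : 5 ≤ N
  · rw [← Condition.ncard_isIneq_and_not_isExceptional hd hdN hN]
    congr 1
    refine ncard_isFacet_eigensteps (by omega) (by omega) _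
      (Condition.finite_isIneq.subset fun c hc => hc.1) (fun c hc => hc.1) ?_ fun c hc => ?_
    · rw [hdesc hN]
      ext x
      refine forall_congr' fun c => imp_congr_left ?_
      have : ¬ c.IsIneq → ¬ c.IsExceptional := fun h => by
        cases c <;> first | exact (h trivial).elim | exact id
      simp only [Set.mem_ofPred_eq]
      tauto
    · obtain ⟨x, hx, hx'⟩ := Condition.exists_violation hd hdN hN hc.2
      exact ⟨x, hx, fun c' _ hne => hx' c' hne⟩
  · obtain rfl : N = 4 := by omega
    obtain rfl : d = 2 := by omega
    rw [ncard_isFacet_eigensteps_four_two]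
    norm_num
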